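/- Let $M$ be a $3$-manifold with boundary $\partial M$ such that the pair $(M,\partial M)$ is homeomorphic either to the thickened torus $(\mathbb T\times[0,1],\ \mathbb T\times\{0,1\})$, where $\mathbb T=\mathbb S^1\times\mathbb S^1$, or to the solid torus $(\mathbb D\times\mathbb S^1,\ \partial\mathbb D\times\mathbb S^1)$, where $\mathbb D\subset\mathbb C$ is the closed unit disc. For a continuous map $K:M\to M$ that is the identity on $\partial M$, let $$\mathrm{var}_K: H_1(M,\partial M;\mathbb Z)\to H_1(M;\mathbb Z),\qquad [\delta]\mapsto [K(\delta)-\delta],$$ be its variation morphism, where $\delta$ runs over the singular $1$-chains of $M$ with boundary in $\partial M$. Let $\chi_0,\chi_1:M\to M$ be two homeomorphisms that are the identity on $\partial M$. Then $\chi_0$ and $\chi_1$ are homotopic relative to $\partial M$ (there is a continuous family of continuous maps $F_t:M\to M$, $t\in[0,1]$, with $F_0=\chi_0$, $F_1=\chi_1$ and $F_t(m)=m$ for all $m\in\partial M$ and all $t$) if and only if $\mathrm{var}_{\chi_0}=\mathrm{var}_{\chi_1}$. -/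

import Mathlib

open CategoryTheory CategoryTheory.Limits

noncomputable section

/-- The integral singular chain complex `C_•(X; ℤ)`. -/
abbrev singularChains (X : Type) [TopologicalSpace X] : ChainComplex (ModuleCat.{0} ℤ) ℕ :=
  ((AlgebraicTopology.singularChainComplexFunctor (ModuleCat.{0} ℤ)).obj
    (ModuleCat.of ℤ ℤ)).obj (TopCat.of X)

/-- The chain map `f_# : C_•(X; ℤ) ⟶ C_•(Y; ℤ)` induced by a continuous map `f : X → Y`. -/
abbrev singularChainsMap {X Y : Type} [TopologicalSpace X] [TopologicalSpace Y] (f : C(X, Y)) :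
    singularChains X ⟶ singularChains Y :=
  ((AlgebraicTopology.singularChainComplexFunctor (ModuleCat.{0} ℤ)).obj
    (ModuleCat.of ℤ ℤ)).map (TopCat.ofHom f)

/-- The inclusion of a subspace, as a continuous map. -/
abbrev subspaceInclusion {X : Type} [TopologicalSpace X] (A : Set X) : C(A, X) :=
  ⟨Subtype.val, continuous_subtype_val⟩

/-- The relative singular chain complex `C_•(X, A; ℤ) = C_•(X; ℤ) / C_•(A; ℤ)`. -/
abbrev relativeSingularChains (X : Type) [TopologicalSpace X] (A : Set X) :
    ChainComplex (ModuleCat.{0} ℤ) ℕ :=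
  cokernel (singularChainsMap (subspaceInclusion A))

/-- Singular homology `H_n(X; ℤ)`. -/
abbrev singularH (X : Type) [TopologicalSpace X] (n : ℕ) : ModuleCat.{0} ℤ :=
  (singularChains X).homology n

/-- Relative singular homology `H_n(X, A; ℤ)`. -/
abbrev relativeSingularH (X : Type) [TopologicalSpace X] (A : Set X) (n : ℕ) :
    ModuleCat.{0} ℤ :=
  (relativeSingularChains X A).homology n

/-- If `K : X → X` is the identity on `A`, then `K_# - id` vanishes on the chains of `A`. -/
theorem singularChainsMap_sub_id_eq_zero {X : Type} [TopologicalSpace X] {A : Set X}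
    (K : C(X, X)) (hK : ∀ a ∈ A, K a = a) :
    singularChainsMap (subspaceInclusion A) ≫ (singularChainsMap K - 𝟙 (singularChains X)) = 0 := by
  have h : TopCat.ofHom (subspaceInclusion A) ≫ TopCat.ofHom K
      = TopCat.ofHom (subspaceInclusion A) := by
    ext a
    exact hK a.1 a.2
  rw [Preadditive.comp_sub, Category.comp_id, ← Functor.map_comp, h, sub_self]

/-- The chain map `C_•(X, A; ℤ) ⟶ C_•(X; ℤ)`, `[δ] ↦ K_#(δ) - δ`, attached to a continuous map
`K : X → X` that is the identity on `A`. -/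
def variationChainMap {X : Type} [TopologicalSpace X] {A : Set X}
    (K : C(X, X)) (hK : ∀ a ∈ A, K a = a) : relativeSingularChains X A ⟶ singularChains X :=
  cokernel.desc (singularChainsMap (subspaceInclusion A))
    (singularChainsMap K - 𝟙 (singularChains X)) (singularChainsMap_sub_id_eq_zero K hK)

/-- The variation morphism `var_K : H_n(X, A; ℤ) ⟶ H_n(X; ℤ)`, `[δ] ↦ [K(δ) - δ]`, relative to `A`,
of a continuous map `K : X → X` that is the identity on `A`. -/
def variation {X : Type} [TopologicalSpace X] {A : Set X}
    (K : C(X, X)) (hK : ∀ a ∈ A, K a = a) (n : ℕ) : relativeSingularH X A n ⟶ singularH X n :=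
  HomologicalComplex.homologyMap (variationChainMap K hK) n

/-- `M` is a thickened torus with boundary `B`: the pair `(M, B)` is homeomorphic to
`(𝕋 × I, 𝕋 × ∂I)`, with `𝕋 = 𝕊¹ × 𝕊¹` and `I = [0, 1]`. -/
def IsThickenedTorus (M : Type) [TopologicalSpace M] (B : Set M) : Prop :=
  ∃ e : M ≃ₜ (Circle × Circle) × unitInterval, ∀ m : M, m ∈ B ↔ (e m).2 = 0 ∨ (e m).2 = 1

/-- `M` is a solid torus with boundary `B`: the pair `(M, B)` is homeomorphic to
`(𝔻 × 𝕊¹, ∂𝔻 × 𝕊¹)`, with `𝔻` the closed unit disc of `ℂ`. -/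
def IsSolidTorus (M : Type) [TopologicalSpace M] (B : Set M) : Prop :=
  ∃ e : M ≃ₜ Metric.closedBall (0 : ℂ) 1 × Circle, ∀ m : M, m ∈ B ↔ ‖((e m).1 : ℂ)‖ = 1

end

/-! A homotopy relative to `A` induces a prism operator which, on chains of `A`, agrees with that of
the constant homotopy. The difference of the two operators therefore descends to relative chains and
is a null-homotopy of the difference of the variation chain maps.

Conversely, each circle coordinate `f` of the model can be deformed from `f ∘ p` to `f ∘ q` by
multiplying by `exp (t L)`, where `L` is a logarithm of `f ∘ q / f ∘ p`; the homotopy is relative to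
the boundary when `L` vanishes there. The remaining coordinate lies in a convex set and moves along
segments.

On the thickened torus, `L` is lifted from `0` on one end along the vertical segments. These are
relative cycles, and the winding of `f` is a cocycle, so equal variations force `L = 0` on the other
end (`log_eq_of_variation_eq`). On the solid torus, `L` is lifted along the segments of the disc
issuing from a boundary point; the ratio is `1` on the connected boundary circles, so `L` stays `0`
there. -/

open CategoryTheory CategoryTheory.Limits

noncomputable section

/-! ### Prism operators and homotopy invariance of the variation. -/

open Simplicial in
theorem CategoryTheory.SimplicialObject.Homotopy.toChainHomotopy_hom_congr {C : Type*} [Category C]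
    [Preadditive C] {A X Y : SimplicialObject C} {f g f' g' : X ⟶ Y}
    (H : SimplicialObject.Homotopy f g) (H' : SimplicialObject.Homotopy f' g') (i : A ⟶ X)
    (h : ∀ (n : ℕ) (k : Fin (n + 1)), i.app (.op ⦋n⦌) ≫ H.h k = i.app (.op ⦋n⦌) ≫ H'.h k)
    (p q : ℕ) :
    i.app (.op ⦋p⦌) ≫ ToChainHomotopy.hom H p q = i.app (.op ⦋p⦌) ≫ ToChainHomotopy.hom H' p q := by
  by_cases hpq : p + 1 = q
  · subst hpq
    simp only [ToChainHomotopy.hom_eq, Preadditive.comp_neg, Preadditive.comp_sum,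
      Preadditive.comp_zsmul, h]
  · rw [ToChainHomotopy.hom_eq_zero _ _ _ hpq, ToChainHomotopy.hom_eq_zero _ _ _ hpq]

-- The prism operator is natural: its value on a simplex depends only on the homotopy over that
-- simplex times `Δ[1]`.
open MonoidalCategory Simplicial in
theorem SSet.Homotopy.chainComplexMap_hom_congr {A X Y : SSet.{0}} {f g f' g' : X ⟶ Y}
    (H : SSet.Homotopy f g) (H' : SSet.Homotopy f' g') (i : A ⟶ X)
    (h : i ▷ Δ[1] ≫ H.h = i ▷ Δ[1] ≫ H'.h) (R : ModuleCat.{0} ℤ) (p q : ℕ) :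
    (SSet.chainComplexMap i R).f p ≫ (H.chainComplexMap R).hom p q =
      (SSet.chainComplexMap i R).f p ≫ (H'.chainComplexMap R).hom p q := by
  refine SimplicialObject.Homotopy.toChainHomotopy_hom_congr
    (H.toSimplicialObjectHomotopy.whiskerRight (sigmaConst.obj R))
    (H'.toSimplicialObjectHomotopy.whiskerRight (sigmaConst.obj R))
    (((SimplicialObject.whiskering _ _).obj (sigmaConst.obj R)).map i) (fun n k => ?_) p q
  have key : i.app _ ≫ H.toSimplicialObjectHomotopy.h k =
      i.app _ ≫ H'.toSimplicialObjectHomotopy.h k := by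
    ext x
    have e : (yonedaEquiv.symm (i.app _ x)) = yonedaEquiv.symm x ≫ i :=
      (yonedaEquiv_symm_comp x i).symm
    change (yonedaEquiv.symm (i.app _ x) ▷ Δ[1] ≫ H.h).app _ _ =
      (yonedaEquiv.symm (i.app _ x) ▷ Δ[1] ≫ H'.h).app _ _
    rw [e, comp_whiskerRight, Category.assoc, Category.assoc, h]
  change (sigmaConst.obj R).map _ ≫ (sigmaConst.obj R).map _ =
    (sigmaConst.obj R).map _ ≫ (sigmaConst.obj R).map _
  rw [← Functor.map_comp, ← Functor.map_comp, key]

/-- A null-homotopy of `π ≫ φ`, where `π` is the projection to a cokernel of `ι`, descends to `φ`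
as soon as it vanishes on `ι`. -/
def Homotopy.cokernelDesc {C : Type*} [Category C] [Abelian C] {K L N : ChainComplex C ℕ}
    (ι : K ⟶ L) (φ : cokernel ι ⟶ N) (h : Homotopy (cokernel.π ι ≫ φ) 0)
    (hι : ∀ i j, ι.f i ≫ h.hom i j = 0) : Homotopy φ 0 := by
  -- Cokernels of complexes are computed degreewise, so each component of the homotopy can be
  -- descended separately.
  have hcol (n : ℕ) := isColimitCoforkMapOfIsColimit' (HomologicalComplex.eval C _ n)
    (cokernel.condition ι) (cokernelIsCokernel ι)
  let d (i j : ℕ) : (cokernel ι).X i ⟶ N.X j :=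
    (hcol i).desc (CokernelCofork.ofπ (h.hom i j) (hι i j))
  have hd (i j : ℕ) : (cokernel.π ι).f i ≫ d i j = h.hom i j :=
    (hcol i).fac (CokernelCofork.ofπ (h.hom i j) (hι i j)) WalkingParallelPair.one
  have hepi (i : ℕ) : Epi ((cokernel.π ι).f i) := inferInstance
  refine ⟨d, fun i j hij => ?_, fun i => ?_⟩
  · rw [← cancel_epi ((cokernel.π ι).f i), hd, h.zero _ _ hij, comp_zero]
  · rw [← cancel_epi ((cokernel.π ι).f i)]
    have := h.comm i
    rw [HomologicalComplex.comp_f] at this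
    rw [this]
    simp only [Preadditive.comp_add, HomologicalComplex.zero_f, comp_zero]
    congr 2
    · simp [dNext, hd]
    · simp only [prevD, AddMonoidHom.mk'_apply, ← Category.assoc, hd]

open MonoidalCategory Simplicial in
theorem TopCat.Homotopy.whiskerRight_toSSet_h {A X Y : TopCat.{0}} {f g f' g' : X ⟶ Y}
    (H : TopCat.Homotopy f g) (H' : TopCat.Homotopy f' g') (i : A ⟶ X)
    (h : ∀ t a, H (t, i a) = H' (t, i a)) :
    TopCat.toSSet.map i ▷ Δ[1] ≫ H.toSSet.h = TopCat.toSSet.map i ▷ Δ[1] ≫ H'.toSSet.h := by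
  have e : i ▷ TopCat.I ≫ H.h = i ▷ TopCat.I ≫ H'.h := by
    ext p
    exact h _ p.1
  have key {f g : X ⟶ Y} (H : TopCat.Homotopy f g) :
      TopCat.toSSet.map i ▷ Δ[1] ≫ H.toSSet.h = _ ◁ SSet.stdSimplex.toSSetObjI ≫
        Functor.LaxMonoidal.μ TopCat.toSSet _ _ ≫ TopCat.toSSet.map (i ▷ TopCat.I ≫ H.h) := by
    dsimp only [TopCat.Homotopy.toSSet]
    rw [← whisker_exchange_assoc, Functor.map_comp, ← Functor.LaxMonoidal.μ_natural_left_assoc]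
  rw [key, key, e]

/-- Variations are invariant under homotopies relative to `A`. -/
theorem variation_eq_of_homotopicRel {X : Type} [TopologicalSpace X] {A : Set X}
    (f g : C(X, X)) (hf : ∀ a ∈ A, f a = a) (hg : ∀ a ∈ A, g a = a)
    (h : f.HomotopicRel g A) (n : ℕ) : variation f hf n = variation g hg n := by
  obtain ⟨F⟩ := h
  let F₁ : TopCat.Homotopy (TopCat.ofHom f) (TopCat.ofHom g) := F.toHomotopy
  let F₀ : TopCat.Homotopy (TopCat.ofHom f) (TopCat.ofHom f) := ContinuousMap.Homotopy.refl f
  let h₁ := F₁.singularChainComplexFunctorObjMap (ModuleCat.of ℤ ℤ)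
  let h₀ := F₀.singularChainComplexFunctorObjMap (ModuleCat.of ℤ ℤ)
  have hπ (K : C(X, X)) (hK : ∀ a ∈ A, K a = a) :
      cokernel.π (singularChainsMap (subspaceInclusion A)) ≫ variationChainMap K hK =
        singularChainsMap K - 𝟙 (singularChains X) := cokernel.π_desc _ _ _
  let k : Homotopy (cokernel.π (singularChainsMap (subspaceInclusion A)) ≫
      (variationChainMap f hf - variationChainMap g hg)) 0 :=
    -- The correction `h₀` is needed: in unnormalized chains the prism operator of a constant
    -- homotopy gives degenerate simplices rather than zero.
    { hom := h₁.hom - h₀.hom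
      zero := fun i j w => by
        rw [Pi.sub_apply, Pi.sub_apply, h₁.zero i j w, h₀.zero i j w, sub_zero]
      comm := fun i => by
        have e₁ := h₁.comm i
        have e₀ := h₀.comm i
        rw [Preadditive.comp_sub, hπ, hπ, sub_sub_sub_cancel_right, map_sub, map_sub,
          HomologicalComplex.sub_f_apply, HomologicalComplex.zero_f]
        rw [right_eq_add] at e₀
        have e₁' : (singularChainsMap f).f i = dNext i h₁.hom + prevD i h₁.hom +
          (singularChainsMap g).f i := e₁
        rw [e₁', add_zero, add_sub_cancel_right, ← add_sub_add_comm, e₀, sub_zero] }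
  have hk : Homotopy (variationChainMap f hf - variationChainMap g hg) 0 := by
    refine Homotopy.cokernelDesc _ _ k fun i j => ?_
    change _ ≫ (h₁.hom i j - h₀.hom i j) = 0
    rw [Preadditive.comp_sub, sub_eq_zero]
    refine SSet.Homotopy.chainComplexMap_hom_congr F₁.toSSet F₀.toSSet
      (TopCat.toSSet.map (TopCat.ofHom (subspaceInclusion A))) ?_ _ i j
    refine TopCat.Homotopy.whiskerRight_toSSet_h F₁ F₀ _ fun t a => ?_
    exact F.eq_fst t a.2
  exact (Homotopy.equivSubZero.symm hk).homologyMap_eq n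

/-! ### Logarithms of circle-valued maps. -/

/-- Every circle-valued map on a contractible space has a logarithm. -/
theorem ContinuousMap.exists_circleExp_comp_eq {X : Type*} [TopologicalSpace X]
    [ContractibleSpace X] (g : C(X, Circle)) : ∃ l : C(X, ℝ), ∀ x, Circle.exp (l x) = g x := by
  obtain ⟨x₀, ⟨H⟩⟩ := id_nullhomotopic X
  obtain ⟨θ, hθ⟩ : ∃ θ, Circle.exp θ = g x₀ := ⟨_, Circle.exp_arg _⟩
  have h0 (x : X) : (g.comp H.symm.toContinuousMap) (0, x) =
      Circle.exp (ContinuousMap.const X θ x) := by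
    simp [hθ]
  let L := Circle.isCoveringMap_exp.liftHomotopy (g.comp H.symm.toContinuousMap) (.const X θ) h0
  refine ⟨L.comp ((ContinuousMap.const X 1).prodMk (.id X)), fun x => ?_⟩
  have := congrFun (Circle.isCoveringMap_exp.liftHomotopy_lifts _ _ h0) (1, x)
  simpa using! this

/-- Two logarithms of the same circle-valued map on a connected space have the same increments. -/
theorem Circle.sub_eq_sub_of_exp_eq {X : Type*} [TopologicalSpace X] [PreconnectedSpace X]
    {l l' : X → ℝ} (hl : Continuous l) (hl' : Continuous l')
    (h : ∀ x, Circle.exp (l x) = Circle.exp (l' x)) (x y : X) : l y - l x = l' y - l' x := by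
  have : ∀ z w, l z - l' z = l w - l' w :=
    Circle.isCoveringMap_exp.const_of_comp (hl.sub hl') fun z w => by simp [Circle.exp_sub, h]
  linarith [this x y]

instance (n : ℕ) : ContractibleSpace (stdSimplex ℝ (Fin (n + 1))) :=
  (convex_stdSimplex ℝ _).contractibleSpace ⟨_, single_mem_stdSimplex ℝ 0⟩

/-! ### Singular simplices and the winding cocycle. -/

open Simplicial

/-- The continuous map underlying a singular simplex. -/
def TopCat.simplexMap {X : TopCat.{0}} {n : ℕ} (σ : (TopCat.toSSet.obj X) _⦋n⦌) :
    C(stdSimplex ℝ (Fin (n + 1)), X) := TopCat.toSSetObjEquiv X _ σ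

/-- The singular simplex given by a continuous map. -/
def TopCat.ofSimplexMap {X : TopCat.{0}} {n : ℕ} (s : C(stdSimplex ℝ (Fin (n + 1)), X)) :
    (TopCat.toSSet.obj X) _⦋n⦌ := (TopCat.toSSetObjEquiv X (.op ⦋n⦌)).symm s

theorem TopCat.simplexMap_ofSimplexMap {X : TopCat.{0}} {n : ℕ}
    (s : C(stdSimplex ℝ (Fin (n + 1)), X)) : simplexMap (ofSimplexMap s) = s :=
  Equiv.apply_symm_apply _ _

theorem TopCat.simplexMap_injective {X : TopCat.{0}} {n : ℕ} :
    Function.Injective (simplexMap : (TopCat.toSSet.obj X) _⦋n⦌ → _) :=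
  (TopCat.toSSetObjEquiv X _).injective

theorem TopCat.simplexMap_δ {X : TopCat.{0}} {n : ℕ} (σ : (TopCat.toSSet.obj X) _⦋n + 1⦌)
    (i : Fin (n + 2)) (s) : simplexMap ((TopCat.toSSet.obj X).δ i σ) s =
      simplexMap σ (stdSimplex.map i.succAbove s) := by
  rfl

theorem TopCat.simplexMap_map {X Y : TopCat.{0}} {n : ℕ} (f : X ⟶ Y)
    (σ : (TopCat.toSSet.obj X) _⦋n⦌) (s) : simplexMap ((TopCat.toSSet.map f).app _ σ) s =
      f (simplexMap σ s) := by
  rfl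

section

variable {X : Type} [TopologicalSpace X]

/-- The total variation of the argument of `f` along a singular `1`-simplex. -/
def windingNumber (f : C(X, Circle)) (σ : (TopCat.toSSet.obj (TopCat.of X)) _⦋1⦌) : ℝ :=
  let l := (f.comp (TopCat.simplexMap σ)).exists_circleExp_comp_eq.choose
  l (stdSimplex.vertex 1) - l (stdSimplex.vertex 0)

theorem windingNumber_eq (f : C(X, Circle)) (σ : (TopCat.toSSet.obj (TopCat.of X)) _⦋1⦌)
    (l : C(stdSimplex ℝ (Fin 2), ℝ)) (hl : ∀ s, Circle.exp (l s) = f (TopCat.simplexMap σ s)) :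
    windingNumber f σ = l (stdSimplex.vertex 1) - l (stdSimplex.vertex 0) :=
  have h := (f.comp (TopCat.simplexMap σ)).exists_circleExp_comp_eq.choose_spec
  Circle.sub_eq_sub_of_exp_eq (ContinuousMap.continuous _) l.continuous
    (fun x => (h x).trans (hl x).symm) _ _

/-- A logarithm on the whole triangle restricts to logarithms on its edges, and the increments
telescope. -/
theorem windingNumber_boundary (f : C(X, Circle)) (σ : (TopCat.toSSet.obj (TopCat.of X)) _⦋2⦌) :
    windingNumber f ((TopCat.toSSet.obj (TopCat.of X)).δ 0 σ) -
      windingNumber f ((TopCat.toSSet.obj (TopCat.of X)).δ 1 σ) +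
      windingNumber f ((TopCat.toSSet.obj (TopCat.of X)).δ 2 σ) = 0 := by
  obtain ⟨l, hl⟩ := (f.comp (TopCat.simplexMap σ)).exists_circleExp_comp_eq
  have h (i : Fin 3) : windingNumber f ((TopCat.toSSet.obj (TopCat.of X)).δ i σ) =
      l (stdSimplex.vertex (i.succAbove 1)) - l (stdSimplex.vertex (i.succAbove 0)) := by
    rw [windingNumber_eq f _ (l.comp ⟨_, stdSimplex.continuous_map i.succAbove⟩)
      (fun s => hl _)]
    simp [stdSimplex.map_vertex]
  rw [h, h, h]
  have e : (0 : Fin 3).succAbove (1 : Fin 2) = 2 := rfl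
  have e' : (1 : Fin 3).succAbove (1 : Fin 2) = 2 := rfl
  have e'' : (2 : Fin 3).succAbove (1 : Fin 2) = 1 := rfl
  have e3 : (0 : Fin 3).succAbove (0 : Fin 2) = 1 := rfl
  have e4 : (1 : Fin 3).succAbove (0 : Fin 2) = 0 := rfl
  have e5 : (2 : Fin 3).succAbove (0 : Fin 2) = 0 := rfl
  rw [e, e', e'', e3, e4, e5]
  ring

/-- The singular chain given by a single singular simplex. -/
def singularChainOf {n : ℕ} (σ : (TopCat.toSSet.obj (TopCat.of X)) _⦋n⦌) :
    ModuleCat.of ℤ ℤ ⟶ (singularChains X).X n :=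
  SSet.ιChainComplex _ σ

theorem singularChains_hom_ext {n : ℕ} {T : ModuleCat.{0} ℤ} {u v : (singularChains X).X n ⟶ T}
    (h : ∀ σ, singularChainOf σ ≫ u = singularChainOf σ ≫ v) : u = v :=
  SSet.chainComplex_hom_ext (X := TopCat.toSSet.obj (TopCat.of X)) h

theorem singularChainOf_d {n : ℕ} (σ : (TopCat.toSSet.obj (TopCat.of X)) _⦋n + 1⦌) :
    singularChainOf σ ≫ (singularChains X).d (n + 1) n =
      ∑ i : Fin (n + 2), (-1) ^ i.val •
        singularChainOf ((TopCat.toSSet.obj (TopCat.of X)).δ i σ) :=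
  SSet.ιChainComplex_d _ _ σ

theorem singularChainOf_map {Y : Type} [TopologicalSpace Y] (f : C(X, Y)) {n : ℕ}
    (σ : (TopCat.toSSet.obj (TopCat.of X)) _⦋n⦌) :
    singularChainOf σ ≫ (singularChainsMap f).f n =
      singularChainOf ((TopCat.toSSet.map (TopCat.ofHom f)).app _ σ) :=
  SSet.ι_chainComplexMap_f _ _ (TopCat.toSSet.map (TopCat.ofHom f)) _ σ

/-- The winding number as a singular `1`-cochain. -/
def windingCochain (f : C(X, Circle)) : (singularChains X).X 1 ⟶ ModuleCat.of ℤ ℝ :=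
  Sigma.desc fun σ => ModuleCat.ofHom (LinearMap.toSpanSingleton ℤ ℝ (windingNumber f σ))

theorem ι_windingCochain (f : C(X, Circle)) (σ : (TopCat.toSSet.obj (TopCat.of X)) _⦋1⦌) :
    singularChainOf σ ≫ windingCochain f =
      ModuleCat.ofHom (LinearMap.toSpanSingleton ℤ ℝ (windingNumber f σ)) :=
  Sigma.ι_desc _ _

theorem d_windingCochain (f : C(X, Circle)) :
    (singularChains X).d 2 1 ≫ windingCochain f = 0 := by
  refine singularChains_hom_ext fun σ => ?_
  rw [reassoc_of% (singularChainOf_d σ), Fin.sum_univ_three, comp_zero]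
  simp only [Preadditive.add_comp, Preadditive.zsmul_comp, ι_windingCochain]
  refine ModuleCat.hom_ext (LinearMap.ext_ring ?_)
  have := windingNumber_boundary f σ
  simp
  linarith

/-- Equal variations change winding numbers along a path relative to `A` by the same amount. -/
theorem windingNumber_eq_of_variation_eq {A : Set X} {p q : C(X, X)} (hp : ∀ a ∈ A, p a = a)
    (hq : ∀ a ∈ A, q a = a) (h : variation p hp 1 = variation q hq 1) (f : C(X, Circle))
    (σ : (TopCat.toSSet.obj (TopCat.of X)) _⦋1⦌)
    (hσ : ∀ i, TopCat.simplexMap σ (stdSimplex.vertex i) ∈ A) :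
    windingNumber f ((TopCat.toSSet.map (TopCat.ofHom p)).app _ σ) =
      windingNumber f ((TopCat.toSSet.map (TopCat.ofHom q)).app _ σ) := by
  let ι := singularChainsMap (subspaceInclusion A)
  -- The endpoints of `σ` are simplices of `A`, so they die in the quotient and `σ` is a relative
  -- cycle.
  have hface (i : Fin 2) : singularChainOf ((TopCat.toSSet.obj (TopCat.of X)).δ i σ) ≫
      (cokernel.π ι).f 0 = (0 : ModuleCat.of ℤ ℤ ⟶ _) := by
    let τ : (TopCat.toSSet.obj (TopCat.of A)) _⦋0⦌ :=
      TopCat.ofSimplexMap (.const _ ⟨_, hσ (i.succAbove 0)⟩)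
    have hτ : (TopCat.toSSet.obj (TopCat.of X)).δ i σ =
        (TopCat.toSSet.map (TopCat.ofHom (subspaceInclusion A))).app _ τ := by
      apply TopCat.simplexMap_injective
      ext s
      rw [TopCat.simplexMap_δ, TopCat.simplexMap_map, TopCat.simplexMap_ofSimplexMap,
        Subsingleton.elim s (stdSimplex.vertex 0), stdSimplex.map_vertex]
      rfl
    rw [hτ, ← singularChainOf_map, Category.assoc]
    have : ι.f 0 ≫ (cokernel.π ι).f 0 = 0 := by
      rw [← HomologicalComplex.comp_f, cokernel.condition, HomologicalComplex.zero_f]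
    exact (congrArg (singularChainOf τ ≫ ·) this).trans comp_zero
  let k : ModuleCat.of ℤ ℤ ⟶ (relativeSingularChains X A).X 1 :=
    singularChainOf σ ≫ (cokernel.π ι).f 1
  have hk : k ≫ (relativeSingularChains X A).d 1 0 = 0 := by
    dsimp only [k]
    rw [Category.assoc, HomologicalComplex.Hom.comm, reassoc_of% (singularChainOf_d σ),
      Fin.sum_univ_two]
    simp only [Preadditive.add_comp, Preadditive.zsmul_comp, hface, smul_zero, add_zero]
  -- Pair the variation of the class of `σ` with the winding cocycle; the term of `σ` itself does
  -- not depend on `K` and cancels below.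
  have key (K : C(X, X)) (hK : ∀ a ∈ A, K a = a) :
      (relativeSingularChains X A).liftCycles k 0 (by simp) hk ≫
        (relativeSingularChains X A).homologyπ 1 ≫ variation K hK 1 ≫
        (singularChains X).homologyι 1 ≫
        (singularChains X).descOpcycles (windingCochain f) 2 (by simp) (d_windingCochain f) =
      ModuleCat.ofHom (LinearMap.toSpanSingleton ℤ ℝ
        (windingNumber f ((TopCat.toSSet.map (TopCat.ofHom K)).app _ σ))) -
      ModuleCat.ofHom (LinearMap.toSpanSingleton ℤ ℝ (windingNumber f σ)) := by
    rw [variation, HomologicalComplex.homologyπ_naturality_assoc,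
      HomologicalComplex.homology_π_ι_assoc, HomologicalComplex.p_descOpcycles,
      HomologicalComplex.cyclesMap_i_assoc, HomologicalComplex.liftCycles_i_assoc]
    dsimp only [k]
    rw [Category.assoc, ← HomologicalComplex.comp_f_assoc, variationChainMap, cokernel.π_desc,
      HomologicalComplex.sub_f_apply, Preadditive.sub_comp, Preadditive.comp_sub,
      HomologicalComplex.id_f, Category.id_comp,
      reassoc_of% (singularChainOf_map K σ), ι_windingCochain, ι_windingCochain]
  have e := key p hp
  rw [h, key q hq, sub_left_inj] at e
  simpa using (ConcreteCategory.congr_hom e (1 : ℤ)).symm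

/-- If `p` and `q` have equal variations, then a logarithm of `f ∘ q / f ∘ p` along a path relative
to `A` takes equal values at the endpoints. -/
theorem log_eq_of_variation_eq {A : Set X} {p q : C(X, X)} (hp : ∀ a ∈ A, p a = a)
    (hq : ∀ a ∈ A, q a = a) (h : variation p hp 1 = variation q hq 1) (f : C(X, Circle))
    (γ : C(unitInterval, X)) (h0 : γ 0 ∈ A) (h1 : γ 1 ∈ A) (L : C(unitInterval, ℝ))
    (hL : ∀ t, Circle.exp (L t) = f (q (γ t)) / f (p (γ t))) : L 0 = L 1 := by
  let e : C(stdSimplex ℝ (Fin 2), unitInterval) := stdSimplexHomeomorphUnitInterval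
  have e0 : e (stdSimplex.vertex 0) = 0 := by
    ext; change (stdSimplex.vertex (S := ℝ) (X := Fin 2) 0).1 1 = _; simp
  have e1 : e (stdSimplex.vertex 1) = 1 := by
    ext; change (stdSimplex.vertex (S := ℝ) (X := Fin 2) 1).1 1 = _; simp
  let σ : (TopCat.toSSet.obj (TopCat.of X)) _⦋1⦌ := TopCat.ofSimplexMap (γ.comp e)
  have hs (s) : TopCat.simplexMap σ s = γ (e s) := by
    rw [TopCat.simplexMap_ofSimplexMap]; rfl
  have hw := windingNumber_eq_of_variation_eq hp hq h f σ (by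
    intro i; rw [hs]; fin_cases i <;> simpa [e0, e1])
  obtain ⟨l, hl⟩ := ((f.comp p).comp (γ.comp e)).exists_circleExp_comp_eq
  rw [windingNumber_eq f _ l (fun s => by rw [TopCat.simplexMap_map, hs]; exact hl s),
    -- Adding `L` to a logarithm of `f ∘ p` along the path gives one of `f ∘ q`.
    windingNumber_eq f _ (l + L.comp e) (fun s => by
      rw [TopCat.simplexMap_map, hs]
      simp [Circle.exp_add, hl, hL])] at hw
  simp [e0, e1] at hw
  linarith

end

/-! ### Normalized logarithms and homotopies on the two models. -/

/-- The point at time `t` on the segment from `x` to `y`, in a convex set. -/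
def Convex.segmentMap {E : Type*} [AddCommGroup E] [Module ℝ E] [TopologicalSpace E]
    [ContinuousAdd E] [ContinuousSMul ℝ E] {s : Set E} (hs : Convex ℝ s) :
    C(unitInterval × s × s, s) where
  toFun p := ⟨(1 - p.1.1) • p.2.1.1 + p.1.1 • p.2.2.1,
    hs p.2.1.2 p.2.2.2 (sub_nonneg.2 p.1.2.2) p.1.2.1 (by ring)⟩
  continuous_toFun := by fun_prop

section

variable {E : Type*} [AddCommGroup E] [Module ℝ E] [TopologicalSpace E]
    [ContinuousAdd E] [ContinuousSMul ℝ E] {s : Set E} (hs : Convex ℝ s)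

@[simp]
theorem Convex.segmentMap_zero (x y : s) : hs.segmentMap (0, x, y) = x :=
  Subtype.ext (by simp [segmentMap])

@[simp]
theorem Convex.segmentMap_one (x y : s) : hs.segmentMap (1, x, y) = y :=
  Subtype.ext (by simp [segmentMap])

@[simp]
theorem Convex.segmentMap_self (t : unitInterval) (x : s) : hs.segmentMap (t, x, x) = x :=
  Subtype.ext (by simp [segmentMap, ← add_smul])

end

/-- On a thickened torus, if `p` and `q` have equal variations, then `f ∘ q / f ∘ p` has a logarithm
vanishing on the boundary. -/
theorem IsThickenedTorus.exists_log {M : Type} [TopologicalSpace M] {B : Set M}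
    (hM : IsThickenedTorus M B) {p q : C(M, M)} (hp : ∀ m ∈ B, p m = m) (hq : ∀ m ∈ B, q m = m)
    (h : variation p hp 1 = variation q hq 1) (f : C(M, Circle)) :
    ∃ L : C(M, ℝ), (∀ m, Circle.exp (L m) = f (q m) / f (p m)) ∧ ∀ m ∈ B, L m = 0 := by
  obtain ⟨e, he⟩ := hM
  have hB (x : Circle × Circle) (t : unitInterval) (ht : t = 0 ∨ t = 1) : e.symm (x, t) ∈ B := by
    simpa [he] using ht
  let g : C(unitInterval × (Circle × Circle), Circle) :=
    ⟨fun y => f (q (e.symm y.swap)) / f (p (e.symm y.swap)), by fun_prop⟩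
  have g0 (x) : g (0, x) = Circle.exp (ContinuousMap.const (Circle × Circle) (0 : ℝ) x) := by
    simp [g, hp _ (hB x 0 (.inl rfl)), hq _ (hB x 0 (.inl rfl))]
  let l := Circle.isCoveringMap_exp.liftHomotopy g _ g0
  have hl (y) : Circle.exp (l y) = g y :=
    congrFun (Circle.isCoveringMap_exp.liftHomotopy_lifts g _ g0) y
  have l0 (x) : l (0, x) = 0 := Circle.isCoveringMap_exp.liftHomotopy_zero g _ g0 x
  have l1 (x) : l (1, x) = 0 := by
    rw [← l0 x]
    refine (log_eq_of_variation_eq hp hq h f ⟨fun t => e.symm (x, t), by fun_prop⟩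
      (hB x 0 (.inl rfl)) (hB x 1 (.inr rfl)) ⟨fun t => l (t, x), by fun_prop⟩ fun t => ?_).symm
    exact hl (t, x)
  refine ⟨⟨fun m => l (e m).swap, by fun_prop⟩, fun m => ?_, fun m hm => ?_⟩
  · simp [hl, g]
  · rcases (he m).1 hm with h0 | h1
    · simpa [Prod.swap, h0] using l0 _
    · simpa [Prod.swap, h1] using l1 _

/-- On a solid torus, if `p` and `q` are the identity on the boundary, then `f ∘ q / f ∘ p` has a
logarithm vanishing on the boundary. -/
theorem IsSolidTorus.exists_log {M : Type} [TopologicalSpace M] {B : Set M}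
    (hM : IsSolidTorus M B) {p q : C(M, M)} (hp : ∀ m ∈ B, p m = m) (hq : ∀ m ∈ B, q m = m)
    (f : C(M, Circle)) :
    ∃ L : C(M, ℝ), (∀ m, Circle.exp (L m) = f (q m) / f (p m)) ∧ ∀ m ∈ B, L m = 0 := by
  obtain ⟨e, he⟩ := hM
  let D := Metric.closedBall (0 : ℂ) 1
  have hD : Convex ℝ D := convex_closedBall _ _
  let c (z : Circle) : D := ⟨z, mem_closedBall_zero_iff.2 z.norm_coe.le⟩
  have hc : Continuous c := by fun_prop
  have hB (z s : Circle) : e.symm (c z, s) ∈ B :=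
    (he _).2 (by rw [e.apply_symm_apply]; exact z.norm_coe)
  let k : C(D × Circle, Circle) :=
    ⟨fun y => f (q (e.symm y)) / f (p (e.symm y)), by fun_prop⟩
  have hk (z s : Circle) : k (c z, s) = 1 := by simp [k, hp _ (hB z s), hq _ (hB z s)]
  -- Contracting the disc to its boundary point `1`, where the ratio is `1`, allows the lift to
  -- start at `0`.
  let g : C(unitInterval × (D × Circle), Circle) :=
    ⟨fun y => k (hD.segmentMap (y.1, c 1, y.2.1), y.2.2), by fun_prop⟩
  have g0 (x) : g (0, x) = Circle.exp (ContinuousMap.const (D × Circle) (0 : ℝ) x) := by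
    simp [g, hk]
  let l := Circle.isCoveringMap_exp.liftHomotopy g _ g0
  have hl (y) : Circle.exp (l y) = g y :=
    congrFun (Circle.isCoveringMap_exp.liftHomotopy_lifts g _ g0) y
  have l0 (x) : l (0, x) = 0 := Circle.isCoveringMap_exp.liftHomotopy_zero g _ g0 x
  -- The segment from `c 1` to itself is constant, so the lift does not move.
  have l1 (s : Circle) : l (1, c 1, s) = 0 := by
    rw [← l0 (c 1, s)]
    refine Circle.isCoveringMap_exp.const_of_comp (g := fun t => l (t, c 1, s)) (by fun_prop)
      (fun t t' => ?_) _ _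
    simp [hl, g]
  have lB (z s : Circle) : l (1, c z, s) = 0 := by
    rw [← l1 s]
    refine Circle.isCoveringMap_exp.const_of_comp (g := fun z => l (1, c z, s)) (by fun_prop)
      (fun t t' => ?_) _ _
    simp [hl, g, hk]
  refine ⟨⟨fun m => l (1, e m), by fun_prop⟩, fun m => ?_, fun m hm => ?_⟩
  · simp [hl, g, k]
  · have hz : (e m).1 = c ⟨(e m).1, by simpa [Submonoid.unitSphere] using (he m).1 hm⟩ := rfl
    have := lB ⟨(e m).1, by simpa [Submonoid.unitSphere] using (he m).1 hm⟩ (e m).2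
    rwa [← hz] at this

/-- On a thickened torus, maps with equal variations are homotopic relative to the boundary. -/
theorem IsThickenedTorus.homotopicRel {M : Type} [TopologicalSpace M] {B : Set M}
    (hM : IsThickenedTorus M B) {p q : C(M, M)} (hp : ∀ m ∈ B, p m = m) (hq : ∀ m ∈ B, q m = m)
    (h : variation p hp 1 = variation q hq 1) : p.HomotopicRel q B := by
  have hlog := hM.exists_log hp hq h
  obtain ⟨e, he⟩ := hM
  obtain ⟨L₁, h₁, h₁'⟩ := hlog ⟨fun m => (e m).1.1, by fun_prop⟩
  obtain ⟨L₂, h₂, h₂'⟩ := hlog ⟨fun m => (e m).1.2, by fun_prop⟩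
  have hI : Convex ℝ unitInterval := convex_Icc _ _
  refine ⟨⟨⟨⟨fun y => e.symm (((e (p y.2)).1.1 * Circle.exp (y.1 * L₁ y.2),
    (e (p y.2)).1.2 * Circle.exp (y.1 * L₂ y.2)),
    hI.segmentMap (y.1, (e (p y.2)).2, (e (q y.2)).2)), by fun_prop⟩, fun m => ?_, fun m => ?_⟩,
    fun t m hm => ?_⟩⟩
  · simp
  · simp [h₁, h₂]
  · simp [h₁' m hm, h₂' m hm, hp m hm, hq m hm]

/-- On a solid torus, maps fixing the boundary are homotopic relative to it. -/
theorem IsSolidTorus.homotopicRel {M : Type} [TopologicalSpace M] {B : Set M}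
    (hM : IsSolidTorus M B) {p q : C(M, M)} (hp : ∀ m ∈ B, p m = m) (hq : ∀ m ∈ B, q m = m) :
    p.HomotopicRel q B := by
  have hlog := hM.exists_log hp hq
  obtain ⟨e, he⟩ := hM
  obtain ⟨L, h, h'⟩ := hlog ⟨fun m => (e m).2, by fun_prop⟩
  have hD : Convex ℝ (Metric.closedBall (0 : ℂ) 1) := convex_closedBall _ _
  refine ⟨⟨⟨⟨fun y => e.symm (hD.segmentMap (y.1, (e (p y.2)).1, (e (q y.2)).1),
    (e (p y.2)).2 * Circle.exp (y.1 * L y.2)), by fun_prop⟩, fun m => ?_, fun m => ?_⟩,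
    fun t m hm => ?_⟩⟩
  · simp
  · simp [h]
  · simp [h' m hm, hp m hm, hq m hm]

end

theorem proposition4p4 (M : Type) [TopologicalSpace M] (B : Set M)
    (hM : IsThickenedTorus M B ∨ IsSolidTorus M B)
    (χ₀ χ₁ : M ≃ₜ M) (h₀ : ∀ m ∈ B, χ₀ m = m) (h₁ : ∀ m ∈ B, χ₁ m = m) :
    ContinuousMap.HomotopicRel (χ₀ : C(M, M)) (χ₁ : C(M, M)) B ↔
      variation (χ₀ : C(M, M)) h₀ 1 = variation (χ₁ : C(M, M)) h₁ 1 :=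
  ⟨fun h => variation_eq_of_homotopicRel _ _ h₀ h₁ h 1,
    fun h => hM.elim (fun hM => hM.homotopicRel h₀ h₁ h) (fun hM => hM.homotopicRel h₀ h₁)⟩
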